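/- **Theorem 7.5.** For $d\ge 0$ let $T_d(\mathbb{Z})$ be the group of upper triangular $d\times d$ integer matrices with all diagonal entries equal to $1$. Let $G$ be a finitely generated torsion-free nilpotent group, of nilpotency class $c$. Then there are an integer $d=d(G)$ and an injective homomorphism $\rho\colon G\to T_d(\mathbb{Z})$; that is, $G$ is isomorphic to a subgroup of $T_d(\mathbb{Z})$. Moreover, $d$ and $\rho$ can be chosen so that, for every field $K$ of characteristic $0$, with $\Delta=\{\sum_x\lambda_x x\in KG:\sum_x\lambda_x=0\}$ the augmentation ideal of the group ring $KG$, the representation $\rho$ describes the action of $G$ by right multiplication on $R=KG/\Delta^{c+1}$ in an integral basis. Precisely, writing $\bar x$ for the image of $x\in G$ in $R$, there is a $K$-basis $b_1,\dots,b_d$ of $R$ such that * each $b_i$ is a (finite) integer linear combination of elements $\bar x$ $(x\in G)$, and each $\bar x$ $(x\in G)$ is an integer linear combination of $b_1,\dots,b_d$; * $b_i\,\bar x=\sum_{j=1}^d\rho(x)_{ij}\,b_j$ for all $x\in G$ and all $1\le i\le d$. -/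

import Mathlib

/-- The unitriangular group `T_d(R)`: invertible `d × d` matrices over `R` that are upper
triangular with all diagonal entries equal to `1`. -/
def unitriangularGroup (d : ℕ) (R : Type*) [CommRing R] : Subgroup (GL (Fin d) R) where
  carrier := {A | (∀ i j, j < i → A i j = 0) ∧ ∀ i, A i i = 1}
  one_mem' := by
    refine ⟨fun i j h => ?_, fun i => ?_⟩
    · simp [Matrix.one_apply_ne h.ne']
    · simp
  mul_mem' := by
    rintro A B ⟨hA, hA'⟩ ⟨hB, hB'⟩
    refine ⟨fun i j h => ?_, fun i => ?_⟩
    · rw [Units.val_mul, Matrix.mul_apply]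
      refine Finset.sum_eq_zero fun k _ => ?_
      rcases lt_or_ge k i with hk | hk
      · rw [hA i k hk, zero_mul]
      · rw [hB k j (h.trans_le hk), mul_zero]
    · rw [Units.val_mul, Matrix.mul_apply, Finset.sum_eq_single i, hA', hB', mul_one]
      · intro k _ hk
        rcases lt_or_gt_of_ne hk with hk | hk
        · rw [hA i k hk, zero_mul]
        · rw [hB k i hk, mul_zero]
      · simp
  inv_mem' := by
    rintro A ⟨hA, hA'⟩
    have hT : Matrix.BlockTriangular ((A⁻¹ : GL (Fin d) R) : Matrix (Fin d) (Fin d) R) id := by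
      have : Invertible (A : Matrix (Fin d) (Fin d) R) := A.invertible
      have h := Matrix.blockTriangular_inv_of_blockTriangular
        (M := (A : Matrix (Fin d) (Fin d) R)) (b := id) (fun i j hij => hA i j hij)
      rwa [← Matrix.coe_units_inv] at h
    refine ⟨fun i j h => hT h, fun i => ?_⟩
    have h1 : ((A : Matrix (Fin d) (Fin d) R) * (A⁻¹ : GL (Fin d) R)) i i = 1 := by
      rw [← Units.val_mul]; simp
    rw [Matrix.mul_apply, Finset.sum_eq_single i, hA', one_mul] at h1
    · exact h1
    · intro k _ hk
      rcases lt_or_gt_of_ne hk with hk | hk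
      · rw [hA i k hk, zero_mul]
      · rw [hT hk, mul_zero]
    · simp

/-- The difference (augmentation) ideal of the group ring `K G`: the kernel of the
ring homomorphism `K G → K` that sums the coefficients. -/
noncomputable abbrev differenceIdeal (K G : Type*) [Field K] [Group G] :
    Ideal (MonoidAlgebra K G) :=
  RingHom.ker (MonoidAlgebra.lift K K G (1 : G →* K))

theorem mem_differenceIdeal_iff {K G : Type*} [Field K] [Group G] (u : MonoidAlgebra K G) :
    u ∈ differenceIdeal K G ↔ (u.coeff.sum fun _ a => a) = 0 := by
  rw [RingHom.mem_ker, MonoidAlgebra.lift_apply]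
  simp

/-- The quotient ring `K G / Δ ^ n`, where `Δ` is the difference ideal of `K G`. -/
abbrev DifferenceQuotient (K G : Type*) [Field K] [Group G] (n : ℕ) : Type _ :=
  MonoidAlgebra K G ⧸ (differenceIdeal K G) ^ n

/-- The natural map of the group `G` into the ring `K G / Δ ^ n`. -/
noncomputable def groupToQuotient (K G : Type*) [Field K] [Group G] (n : ℕ) :
    G →* DifferenceQuotient K G n :=
  ((Ideal.Quotient.mk ((differenceIdeal K G) ^ n) :
      MonoidAlgebra K G →+* DifferenceQuotient K G n) :
    MonoidAlgebra K G →* DifferenceQuotient K G n).comp (MonoidAlgebra.of K G)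

/-- A `K`-basis of `K G / Δ ^ n` is integral if its members are integral combinations of
(the images of) group elements and, conversely, every group element is an integral combination
of members of the basis. -/
def IsIntegralBasis {K G : Type*} [Field K] [Group G] {n d : ℕ}
    (b : Module.Basis (Fin d) K (DifferenceQuotient K G n)) : Prop :=
  (∀ i, ∃ m : G →₀ ℤ, b i = m.sum fun x a => a • groupToQuotient K G n x) ∧
    ∀ x : G, ∃ m : Fin d → ℤ, groupToQuotient K G n x = ∑ i, m i • b i

/-! In `ℚG/Δⁿ` right multiplication by `x - 1` carries the image of `Δᵏ` into that of `Δᵏ⁺¹`, so `G`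
acts unipotently, and it preserves the lattice `L` of integral combinations of group elements. `L`
is finitely generated because `G` is and `Δ` is nilpotent in the quotient. The traces of the `Δᵏ` on
`L` are isolated, `Δᵏ` being a rational subspace, so bases of the free successive factors lift to a
basis of `L` in which `G` is unitriangular (`exists_integral_unitriangular_basis`). The same
matrices serve over every `K` because `Δⁿ` over `K` is spanned by integral elements already in `Δⁿ`
over `ℚ` (`differenceIdeal.pow_le_span_integral`).

An `x` acting trivially satisfies `x - 1 ∈ Δⁿ`; the hard point is that `x = 1` when `n = c + 1`. Let
`F i` be the isolator of the `i`-th term of the lower central series: `⁅F i, F j⁆ ≤ F (i + j)`, the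
factors are torsion-free, and `F (c + 1) = ⊥`. Give `g - 1` weight `w` when `g ∈ F w`, and add
weights in products, so that `Δⁿ` consists of elements of weight at least `n`. Then `x - 1` of
weight `n` forces `x ∈ F n` (`IsIsolatedFiltration.weightFaithful`). This is proved up the
filtration, one infinite cyclic factor at a time: if `N = N' ⋊ ⟨t⟩`, a retraction of `ℚN` onto `ℚN'`
loses no weight (`WeightFaithful.of_ker`). -/

open scoped commutatorElement

/-! ### Commutators of terms of the lower central series. -/

namespace Subgroup

variable {G : Type*} [Group G]

theorem commutator_commutator_le_of_rotate {H₁ H₂ H₃ N : Subgroup G} [N.Normal]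
    (h1 : ⁅⁅H₂, H₃⁆, H₁⁆ ≤ N) (h2 : ⁅⁅H₃, H₁⁆, H₂⁆ ≤ N) : ⁅⁅H₁, H₂⁆, H₃⁆ ≤ N := by
  have key : ∀ H : Subgroup G, H ≤ N ↔ H.map (QuotientGroup.mk' N) = ⊥ := fun H => by
    rw [map_eq_bot_iff, QuotientGroup.ker_mk']
  simp only [key, map_commutator] at h1 h2 ⊢
  exact commutator_commutator_eq_bot_of_rotate h1 h2

/-- Three subgroups lemma, applied to the term of index `b + 1` as a commutator with the whole
group. The extra `1` is due to the series being indexed from `0`. -/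
theorem commutator_lowerCentralSeries_le (a b : ℕ) :
    ⁅(⊤ : Subgroup G).lowerCentralSeries a, (⊤ : Subgroup G).lowerCentralSeries b⁆ ≤
      (⊤ : Subgroup G).lowerCentralSeries (a + b + 1) := by
  induction b generalizing a with
  | zero => exact le_of_eq (lowerCentralSeries_succ ⊤ a).symm
  | succ b ih =>
    rw [commutator_comm, lowerCentralSeries_succ]
    apply commutator_commutator_le_of_rotate
    · rw [commutator_comm ⊤, ← lowerCentralSeries_succ]
      refine (ih (a + 1)).trans (lowerCentralSeries_antitone ⊤ (by omega))
    · refine (commutator_mono (ih a) le_rfl).trans ?_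
      rw [← lowerCentralSeries_succ]
      exact lowerCentralSeries_antitone ⊤ (by omega)

end Subgroup

/-! ### Roots and commutators in torsion-free nilpotent groups. -/

theorem commutatorElement_pow_left {G : Type*} [Group G] {a b : G} (h : Commute ⁅a, b⁆ a)
    (m : ℕ) : ⁅a ^ m, b⁆ = ⁅a, b⁆ ^ m := by
  have hb : b * a * b⁻¹ = ⁅a, b⁆⁻¹ * a := by
    rw [commutatorElement_def]; group
  rw [commutatorElement_def, mul_assoc _ b, mul_assoc, ← inv_pow, ← conj_pow,
    show b * a⁻¹ * b⁻¹ = (b * a * b⁻¹)⁻¹ by group, hb, inv_pow, h.inv_left.mul_pow,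
    inv_pow, mul_inv_rev, inv_inv, mul_inv_cancel_left]

section TorsionFree

variable {G : Type*} [Group G]

/-- If the commutator of `x` and `y` is central modulo a normal subgroup `N`, then
`⁅x ^ m, y⁆ ≡ ⁅x, y⁆ ^ m` modulo `N`. -/
theorem commutatorElement_pow_mem_iff {N : Subgroup G} [N.Normal] {x y : G}
    (h : ⁅⁅x, y⁆, x⁆ ∈ N) (m : ℕ) : ⁅x ^ m, y⁆ ∈ N ↔ ⁅x, y⁆ ^ m ∈ N := by
  rw [← QuotientGroup.eq_one_iff, ← QuotientGroup.mk'_apply, map_commutatorElement,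
    map_commutatorElement, commutatorElement_eq_one_iff_commute] at h
  rw [← QuotientGroup.eq_one_iff, ← QuotientGroup.eq_one_iff (⁅x, y⁆ ^ m),
    ← QuotientGroup.mk'_apply, ← QuotientGroup.mk'_apply, map_commutatorElement, map_pow, map_pow,
    map_commutatorElement, commutatorElement_pow_left h]

/-- Upper central factors inherit torsion-freeness: commutation with a fixed `y` is compatible with
powers modulo the next lower term, which moves the question one layer down. -/
theorem mem_upperCentralSeries_of_pow_mem (htf : ∀ (x : G) (m : ℕ), m ≠ 0 → x ^ m = 1 → x = 1)
    {m : ℕ} (hm : m ≠ 0) (i : ℕ) {x : G} (hx : x ∈ Subgroup.upperCentralSeries G (i + 1))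
    (hxm : x ^ m ∈ Subgroup.upperCentralSeries G i) : x ∈ Subgroup.upperCentralSeries G i := by
  induction i generalizing x with
  | zero =>
    rw [Subgroup.upperCentralSeries_zero, Subgroup.mem_bot] at hxm ⊢
    exact htf x m hm hxm
  | succ i ih =>
    intro y
    have h : ⁅x, y⁆ ∈ Subgroup.upperCentralSeries G (i + 1) := hx y
    exact ih h ((commutatorElement_pow_mem_iff (N := Subgroup.upperCentralSeries G i) (h x) m).1 (hxm y))

/-- `⁅x, y⁆` descends the upper central series: if it lies in term `i + 1`, its `m`-th power is
congruent to `⁅x ^ m, y⁆ = 1` modulo term `i`, and that factor is torsion-free. -/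
theorem commutatorElement_eq_one_of_pow_left [Group.IsNilpotent G]
    (htf : ∀ (x : G) (m : ℕ), m ≠ 0 → x ^ m = 1 → x = 1)
    {m : ℕ} (hm : m ≠ 0) {x y : G} (h : ⁅x ^ m, y⁆ = 1) : ⁅x, y⁆ = 1 := by
  have key : ∀ i, ⁅x, y⁆ ∈ Subgroup.upperCentralSeries G i → ⁅x, y⁆ = 1 := by
    intro i
    induction i with
    | zero => exact fun hi => by simpa using hi
    | succ i ih =>
      refine fun hi => ih (mem_upperCentralSeries_of_pow_mem htf hm i hi ?_)
      rw [← commutatorElement_pow_mem_iff (N := Subgroup.upperCentralSeries G i) (hi x), h]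
      exact one_mem _
  obtain ⟨n, hn⟩ := Group.IsNilpotent.nilpotent G
  exact key n (hn ▸ Subgroup.mem_top _)

end TorsionFree

/-! ### Isolators and isolated filtrations. -/

namespace Subgroup

variable {G : Type*} [Group G]

/-- A normal subgroup with torsion-free quotient. -/
structure IsIsolated (M : Subgroup G) : Prop where
  normal : M.Normal
  mem_of_pow_mem : ∀ (x : G) (m : ℕ), m ≠ 0 → x ^ m ∈ M → x ∈ M

/-- The smallest normal subgroup with torsion-free quotient containing `H`. -/
def isolator (H : Subgroup G) : Subgroup G :=
  sInf {M | M.IsIsolated ∧ H ≤ M}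

theorem le_isolator (H : Subgroup G) : H ≤ H.isolator := le_sInf fun _ h => h.2

theorem isolator_le {H M : Subgroup G} (hM : M.IsIsolated) (h : H ≤ M) : H.isolator ≤ M :=
  sInf_le ⟨hM, h⟩

theorem isIsolated_isolator (H : Subgroup G) : H.isolator.IsIsolated where
  normal := by
    refine ⟨fun n hn g => ?_⟩
    rw [isolator, mem_sInf] at hn ⊢
    exact fun M hM => hM.1.normal.conj_mem n (hn M hM) g
  mem_of_pow_mem x m hm h := by
    rw [isolator, mem_sInf] at h ⊢
    exact fun M hM => hM.1.mem_of_pow_mem x m hm (h M hM)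

theorem isolator_mono {H K : Subgroup G} (h : H ≤ K) : H.isolator ≤ K.isolator :=
  isolator_le (isIsolated_isolator K) (h.trans (le_isolator K))

/-- The elements commuting with `A` modulo `M` form a normal subgroup. It is closed under roots
because `G ⧸ M` is torsion-free nilpotent, so once it contains `B` it contains the isolator. -/
theorem commutator_isolator_le_of_commutator_le [Group.IsNilpotent G] {A B M : Subgroup G}
    [A.Normal] (hM : M.IsIsolated) (h : ⁅A, B⁆ ≤ M) : ⁅A, B.isolator⁆ ≤ M := by
  have := hM.normal
  have key : ∀ H : Subgroup G, ⁅A, H⁆ ≤ M ↔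
      H ≤ (centralizer (A.map (QuotientGroup.mk' M) : Set (G ⧸ M))).comap
        (QuotientGroup.mk' M) := fun H => by
    rw [← map_le_iff_le_comap, ← commutator_eq_bot_iff_le_centralizer, ← map_commutator,
      map_eq_bot_iff, QuotientGroup.ker_mk', commutator_comm]
  rw [key] at h ⊢
  have : (A.map (QuotientGroup.mk' M)).Normal :=
    Normal.map inferInstance _ (QuotientGroup.mk'_surjective M)
  refine isolator_le ⟨inferInstance, fun x m hm hx => ?_⟩ h
  rw [mem_comap, mem_centralizer_iff_commutator_eq_one'] at hx ⊢
  intro y hy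
  refine commutatorElement_eq_one_of_pow_left (fun z k hk hz => ?_) hm ?_
  · obtain ⟨z, rfl⟩ := QuotientGroup.mk_surjective z
    rw [← QuotientGroup.mk_pow, QuotientGroup.eq_one_iff] at hz
    exact (QuotientGroup.eq_one_iff z).2 (hM.mem_of_pow_mem z k hk hz)
  · rw [← map_pow]
    exact hx y hy

theorem commutator_isolator_isolator_le [Group.IsNilpotent G] {A B M : Subgroup G}
    [A.Normal] (hM : M.IsIsolated) (h : ⁅A, B⁆ ≤ M) : ⁅A.isolator, B.isolator⁆ ≤ M := by
  have := (isIsolated_isolator B).normal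
  rw [commutator_comm]
  apply commutator_isolator_le_of_commutator_le hM
  rw [commutator_comm]
  exact commutator_isolator_le_of_commutator_le hM h

end Subgroup

/-- A descending filtration of a group by normal subgroups, starting from the whole group, with
torsion-free quotients and `⁅F i, F j⁆ ≤ F (i + j)`. -/
structure IsIsolatedFiltration {G : Type*} [Group G] (F : ℕ → Subgroup G) : Prop where
  antitone : Antitone F
  zero : F 0 = ⊤
  isolated : ∀ n, (F n).IsIsolated
  commutator_le : ∀ i j, ⁅F i, F j⁆ ≤ F (i + j)

/-- The isolators of the lower central series, starting at index `1`. -/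
theorem isIsolatedFiltration_isolator_lowerCentralSeries (G : Type*) [Group G]
    [Group.IsNilpotent G] :
    IsIsolatedFiltration fun n => ((⊤ : Subgroup G).lowerCentralSeries (n - 1)).isolator where
  antitone i j h := Subgroup.isolator_mono (Subgroup.lowerCentralSeries_antitone ⊤ (by omega))
  zero := top_unique (Subgroup.le_isolator ⊤)
  isolated n := Subgroup.isIsolated_isolator _
  commutator_le i j := by
    refine Subgroup.commutator_isolator_isolator_le (Subgroup.isIsolated_isolator _)
      (le_trans ?_ (Subgroup.le_isolator _))
    -- Truncated subtraction makes `F 0 = F 1 = ⊤`; for a zero index normality suffices, and for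
    -- positive indices the shift by one matches the indexing from `0`.
    rcases Nat.eq_zero_or_pos i with rfl | hi
    · simpa using Subgroup.commutator_le_right _ _
    rcases Nat.eq_zero_or_pos j with rfl | hj
    · simpa using Subgroup.commutator_le_left _ _
    refine (Subgroup.commutator_lowerCentralSeries_le _ _).trans
      (Subgroup.lowerCentralSeries_antitone ⊤ (by omega))

/-! ### Weights in the rational group ring. -/

/-- Products `(g₁ - 1) ⋯ (gₖ - 1)` in the rational group ring with `gᵢ ∈ N ∩ F wᵢ`, weighted by
`w₁ + ⋯ + wₖ`. -/
inductive IsWeightedProduct {G : Type*} [Group G] (F : ℕ → Subgroup G) (N : Subgroup G) :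
    ℕ → MonoidAlgebra ℚ G → Prop
  | one : IsWeightedProduct F N 0 1
  | mul {m w : ℕ} {u : MonoidAlgebra ℚ G} {g : G} : IsWeightedProduct F N m u → g ∈ N → g ∈ F w →
      IsWeightedProduct F N (m + w) (u * (MonoidAlgebra.of ℚ G g - 1))

/-- The span of the weighted products of weight at least `n`. -/
noncomputable def weightSpan {G : Type*} [Group G] (F : ℕ → Subgroup G) (N : Subgroup G) (n : ℕ) :
    Submodule ℚ (MonoidAlgebra ℚ G) :=
  Submodule.span ℚ {u | ∃ m, n ≤ m ∧ IsWeightedProduct F N m u}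

/-- The linear extension of a function on the monoid to its monoid algebra. -/
noncomputable def MonoidAlgebra.linExt {K G V : Type*} [Field K] [Monoid G] [AddCommGroup V]
    [Module K V] (f : G → V) : MonoidAlgebra K G →ₗ[K] V :=
  (Finsupp.lift V K G f).comp (MonoidAlgebra.coeffLinearEquiv K).toLinearMap

theorem MonoidAlgebra.linExt_of {K G V : Type*} [Field K] [Monoid G] [AddCommGroup V]
    [Module K V] (f : G → V) (g : G) : linExt f (of K G g) = f g := by
  simp [linExt]

theorem MonoidAlgebra.linExt_one {K G V : Type*} [Field K] [Monoid G] [AddCommGroup V]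
    [Module K V] (f : G → V) : linExt (K := K) f 1 = f 1 := by
  rw [← map_one (of K G), linExt_of]

namespace IsIsolatedFiltration

open MonoidAlgebra

variable {G : Type*} [Group G] {F : ℕ → Subgroup G} {N : Subgroup G}

theorem weightSpan_antitone : Antitone (weightSpan F N) := fun _ _ h =>
  Submodule.span_mono fun _ ⟨m, hm, hu⟩ => ⟨m, h.trans hm, hu⟩

theorem one_mem_weightSpan : 1 ∈ weightSpan F N 0 :=
  Submodule.subset_span ⟨0, le_rfl, .one⟩

theorem mul_of_sub_one_mem_weightSpan {m w : ℕ} {u : MonoidAlgebra ℚ G} {g : G}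
    (hu : u ∈ weightSpan F N m) (hg : g ∈ N) (hw : g ∈ F w) :
    u * (of ℚ G g - 1) ∈ weightSpan F N (m + w) := by
  induction hu using Submodule.span_induction with
  | mem u h =>
    obtain ⟨k, hk, hu⟩ := h
    exact Submodule.subset_span ⟨k + w, by omega, hu.mul hg hw⟩
  | zero => simp
  | add u v _ _ hu hv => rw [add_mul]; exact add_mem hu hv
  | smul a u _ hu => rw [smul_mul_assoc]; exact Submodule.smul_mem _ a hu

theorem mul_of_mem_weightSpan (hF : F 0 = ⊤) {m : ℕ} {u : MonoidAlgebra ℚ G} {g : G}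
    (hu : u ∈ weightSpan F N m) (hg : g ∈ N) : u * of ℚ G g ∈ weightSpan F N m := by
  have h := mul_of_sub_one_mem_weightSpan (w := 0) hu hg (hF ▸ Subgroup.mem_top g)
  simpa [mul_sub] using add_mem h hu

/-- The linear extension `D` of `k` is a derivation along the augmentation `ε`, so `D (u * (g - 1))
= ε u * k g`. This vanishes if `u` contains a factor `h - 1`; otherwise `g` alone carries the
weight, lies in `F (v + 1)`, and `k g = 0`. -/
theorem linExt_eq_zero_of_mem_weightSpan (hF : Antitone F) {v : ℕ} {k : G → ℤ}
    (hk : ∀ g ∈ N, ∀ h ∈ N, k (g * h) = k g + k h) (hk0 : ∀ g ∈ F (v + 1), k g = 0)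
    {u : MonoidAlgebra ℚ G} (hu : u ∈ weightSpan F N (v + 1)) :
    linExt (K := ℚ) (fun g => (k g : ℚ)) u = 0 := by
  set D := linExt (K := ℚ) fun g => (k g : ℚ)
  set ε := linExt (K := ℚ) fun _ : G => (1 : ℚ)
  have hε : ∀ (u : MonoidAlgebra ℚ G) (g : G), ε (u * of ℚ G g) = ε u := fun u g => by
    have : ε.comp (LinearMap.mulRight ℚ (of ℚ G g)) = ε := by
      ext x; simp [ε, linExt, MonoidAlgebra.single_mul_single]
    exact LinearMap.congr_fun this u
  have hD : ∀ m u, IsWeightedProduct F N m u → ∀ g ∈ N, D (u * of ℚ G g) = D u + ε u * k g := by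
    intro m u hu
    induction hu with
    | one =>
      intro g hg
      have := hk 1 (one_mem _) 1 (one_mem _)
      rw [one_mul, linExt_of, linExt_one, linExt_one]
      simp_all
    | @mul m w u h _ hh _ ih =>
      intro g hg
      rw [mul_sub, sub_mul, map_sub, map_sub, map_sub, mul_one, hε, sub_self, mul_assoc, ← map_mul,
        ih _ (mul_mem hh hg), ih _ hg, ih _ hh, hk h hh g hg]
      push_cast
      ring
  have hε0 : ∀ m u, IsWeightedProduct F N m u → m = 0 ∨ ε u = 0 := by
    intro m u hu
    cases hu with
    | one => exact .inl rfl
    | mul => right; rw [mul_sub, map_sub, hε, mul_one, sub_self]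
  refine Submodule.span_induction (p := fun u _ => D u = 0) ?_ (map_zero D)
    (fun x y _ _ hx hy => by rw [map_add, hx, hy, add_zero])
    (fun a x _ hx => by rw [map_smul, hx, smul_zero]) hu
  rintro _ ⟨m, hm, hu⟩
  cases hu with
  | one => omega
  | @mul m w u g hu hg hw =>
    rw [mul_sub, map_sub, mul_one, hD _ _ hu g hg, add_sub_cancel_left]
    rcases hε0 _ _ hu with rfl | h
    · rw [hk0 g (hF (by omega) hw), Int.cast_zero, mul_zero]
    · rw [h, zero_mul]

/-- Conjugation by `s` multiplies a factor `g` of weight `a` by `⁅g⁻¹, s⁻¹⁆`, which has weight `a +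
w`. -/
theorem conj_sub_mem_weightSpan (hF : IsIsolatedFiltration F) {m w : ℕ}
    {u : MonoidAlgebra ℚ G} (hu : u ∈ weightSpan F N m) {s : G} (hs : s ∈ F w)
    (hN : ∀ g ∈ N, ⁅g⁻¹, s⁻¹⁆ ∈ N) :
    of ℚ G s⁻¹ * u * of ℚ G s - u ∈ weightSpan F N (m + w) := by
  have key : ∀ m u, IsWeightedProduct F N m u →
      of ℚ G s⁻¹ * u * of ℚ G s - u ∈ weightSpan F N (m + w) := by
    intro m u hu
    induction hu with
    | one => rw [mul_one, ← map_mul, inv_mul_cancel, map_one, sub_self]; exact zero_mem _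
    | @mul m a u g hu hg ha ih =>
      have hc : ⁅g⁻¹, s⁻¹⁆ ∈ F (a + w) := hF.commutator_le a w
        (Subgroup.commutator_mem_commutator (inv_mem ha) (inv_mem hs))
      have hu' : u ∈ weightSpan F N m := Submodule.subset_span ⟨m, le_rfl, hu⟩
      have hN' := hN g hg
      have hconj : s⁻¹ * g * s = g * ⁅g⁻¹, s⁻¹⁆ := by rw [commutatorElement_def]; group
      have e : of ℚ G s⁻¹ * (u * (of ℚ G g - 1)) * of ℚ G s - u * (of ℚ G g - 1) =
          (of ℚ G s⁻¹ * u * of ℚ G s - u) * (of ℚ G (s⁻¹ * g * s) - 1) +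
            u * of ℚ G g * (of ℚ G ⁅g⁻¹, s⁻¹⁆ - 1) := by
        have e1 : u * of ℚ G g * of ℚ G ⁅g⁻¹, s⁻¹⁆ = u * of ℚ G (s⁻¹ * g * s) := by
          rw [hconj, map_mul, mul_assoc]
        have e2 : of ℚ G s⁻¹ * u * of ℚ G s * of ℚ G (s⁻¹ * g * s) =
            of ℚ G s⁻¹ * u * of ℚ G g * of ℚ G s := by
          rw [mul_assoc, ← map_mul, mul_assoc _ (of ℚ G g), ← map_mul]
          congr 2
          group
        simp only [mul_sub, sub_mul, e1, e2, mul_one]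
        simp only [mul_assoc]
        abel
      rw [e]
      refine add_mem ?_ ?_
      · refine weightSpan_antitone (by omega : m + a + w ≤ (m + w) + a)
          (mul_of_sub_one_mem_weightSpan ih ?_ ?_)
        · rw [hconj]; exact mul_mem hg hN'
        · rw [hconj]; exact mul_mem ha (hF.antitone (by omega) hc)
      · rw [add_assoc]
        exact mul_of_sub_one_mem_weightSpan (mul_of_mem_weightSpan hF.zero hu' hg) hN' hc
  induction hu using Submodule.span_induction with
  | mem u h =>
    obtain ⟨k, hk, hu⟩ := h
    exact weightSpan_antitone (by omega) (key k u hu)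
  | zero => simp
  | add x y _ _ hx hy =>
    convert add_mem hx hy using 1
    noncomm_ring
  | smul a x _ hx =>
    convert Submodule.smul_mem _ a hx using 1
    simp [smul_sub]

/-- The group elements congruent to `1` modulo weight `n` lie in `F n`. -/
def WeightFaithful (F : ℕ → Subgroup G) (N : Subgroup G) : Prop :=
  ∀ n, ∀ x ∈ N, of ℚ G x - 1 ∈ weightSpan F N n → x ∈ F n

/-- Here `N = N' ⋊ ⟨t⟩`. Let `N` act on `ℚN'` on the right, `N'` by multiplication and `t` by
conjugation; explicitly `g` sends `u` to `(s g)⁻¹ u g` with `s g = t ^ k g`. For `g ∈ F w` the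
operator `g - 1` raises weight by `w`, so the orbit map `Ψ` of `1` preserves weight. If `n > v`, the
derivation argument gives `k x = 0`, whence `Ψ (x - 1) = x - 1` and the hypothesis on `N'` applies.
-/
theorem WeightFaithful.of_ker (hF : IsIsolatedFiltration F) {v : ℕ} (hv : 1 ≤ v)
    {N N' : Subgroup G} (hNv : N ≤ F v) (hvN : F (v + 1) ≤ N) {k : G → ℤ}
    (hk : ∀ g ∈ N, ∀ h ∈ N, k (g * h) = k g + k h) (hk0 : ∀ g ∈ F (v + 1), k g = 0)
    {t : G} (ht : t ∈ N) (hkt : k t = 1) (hN' : ∀ g, g ∈ N' ↔ g ∈ N ∧ k g = 0)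
    (hfaith : WeightFaithful F N') : WeightFaithful F N := by
  intro n x hx hxn
  rcases le_or_gt n v with hn | hn
  · exact hF.antitone hn (hNv hx)
  have hk1 : k 1 = 0 := hk0 1 (one_mem _)
  have hkx : k x = 0 := by
    have := linExt_eq_zero_of_mem_weightSpan hF.antitone hk hk0
      (weightSpan_antitone (by omega : v + 1 ≤ n) hxn)
    rw [map_sub, linExt_of, linExt_one, hk1] at this
    simpa using this
  have hkinv : ∀ g ∈ N, k g⁻¹ = - k g := fun g hg => by
    have := hk g hg g⁻¹ (inv_mem hg)
    rw [mul_inv_cancel, hk1] at this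
    omega
  have hkpow : ∀ (n : ℕ), k (t ^ n) = n := fun n => by
    induction n with
    | zero => simp [hk1]
    | succ n ih => rw [pow_succ, hk _ (pow_mem ht n) _ ht, ih, hkt]; simp
  have hkzpow : ∀ n : ℤ, k (t ^ n) = n := fun n => by
    cases n with
    | ofNat n => simp [hkpow]
    | negSucc n => rw [zpow_negSucc, hkinv _ (pow_mem ht _), hkpow]; rfl
  -- `v ≥ 1` enters here: `F (v + v) ≤ F (v + 1)`.
  have hcomm : ∀ g ∈ N', ∀ s ∈ F v, ⁅g⁻¹, s⁻¹⁆ ∈ N' := fun g hg s hs => by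
    have : ⁅g⁻¹, s⁻¹⁆ ∈ F (v + 1) := hF.antitone (by omega : v + 1 ≤ v + v)
      (hF.commutator_le v v (Subgroup.commutator_mem_commutator
        (inv_mem (hNv ((hN' g).1 hg).1)) (inv_mem hs)))
    exact (hN' _).2 ⟨hvN this, hk0 _ this⟩
  -- the retraction of `N` onto the powers of `t`
  let s : G → G := fun g => t ^ k g
  have hs : ∀ g, s g ∈ F v := fun g => zpow_mem (hNv ht) _
  have hact : ∀ (m w : ℕ) (u : MonoidAlgebra ℚ G) (g : G), u ∈ weightSpan F N' m → g ∈ N →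
      g ∈ F w → of ℚ G (s g)⁻¹ * u * of ℚ G g - u ∈ weightSpan F N' (m + w) := by
    intro m w u g hu hg hw
    -- The retraction loses no weight: for `w ≤ v` any power of `t` will do, and for `w > v` the
    -- exponent is `0`.
    have hsw : s g ∈ F w := by
      rcases le_or_gt w v with h | h
      · exact hF.antitone h (hs g)
      · have : k g = 0 := hk0 g (hF.antitone h hw)
        simp [s, this]
    have hy : (s g)⁻¹ * g ∈ N' := by
      rw [hN']
      have h1 : s g ∈ N := zpow_mem ht _
      refine ⟨mul_mem (inv_mem h1) hg, ?_⟩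
      rw [hk _ (inv_mem h1) _ hg, hkinv _ h1, hkzpow, neg_add_cancel]
    have h1 := conj_sub_mem_weightSpan hF hu hsw fun x hx => hcomm x hx _ (hs g)
    have h2 := mul_of_sub_one_mem_weightSpan hu hy (mul_mem (inv_mem hsw) hw)
    -- With `y = (s g)⁻¹ g`: `s⁻¹ u g - u = (s⁻¹ u s - u) y + u (y - 1)`.
    convert add_mem (mul_of_mem_weightSpan hF.zero h1 hy) h2 using 1
    have : of ℚ G (s g) * of ℚ G ((s g)⁻¹ * g) = of ℚ G g := by
      rw [← map_mul, mul_inv_cancel_left]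
    rw [sub_mul, mul_assoc (_ * u), this]
    noncomm_ring
  let Ψ := linExt (K := ℚ) fun g => of ℚ G ((s g)⁻¹ * g)
  have hΨ : ∀ m u, IsWeightedProduct F N m u →
      ∀ h ∈ N, Ψ (u * of ℚ G h) = of ℚ G (s h)⁻¹ * Ψ u * of ℚ G h := by
    intro m u hu
    induction hu with
    | one =>
      intro h _
      rw [one_mul, linExt_of, linExt_one, map_mul]
      simp [s, hk1]
    | @mul m w u g _ hg _ ih =>
      intro h hh
      have e : s (g * h) = s g * s h := by simp only [s]; rw [hk g hg h hh, zpow_add]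
      rw [mul_sub, mul_one, sub_mul, map_sub, map_sub, mul_assoc, ← map_mul,
        ih _ (mul_mem hg hh), ih _ hh, ih _ hg, e, mul_inv_rev, map_mul, map_mul]
      noncomm_ring
  have hΨmem : ∀ m u, IsWeightedProduct F N m u → Ψ u ∈ weightSpan F N' m := by
    intro m u hu
    induction hu with
    | one =>
      rw [linExt_one]
      simpa [s, hk1, ← MonoidAlgebra.one_def] using one_mem_weightSpan
    | @mul m w u g hu hg hw ih =>
      rw [mul_sub, mul_one, map_sub, hΨ m u hu g hg]
      exact hact m w _ g ih hg hw
  have hle : weightSpan F N n ≤ (weightSpan F N' n).comap Ψ :=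
    Submodule.span_le.2 fun u ⟨m, hm, hu⟩ => weightSpan_antitone hm (hΨmem m u hu)
  have := hle hxn
  rw [Submodule.mem_comap, map_sub, linExt_of, linExt_one] at this
  exact hfaith n x ((hN' x).2 ⟨hx, hkx⟩) (by simpa [s, hkx, hk1, ← MonoidAlgebra.one_def] using this)

/-- Induction on the rank of `N / F (v + 1) ≅ ℤ ^ r`: the first coordinate plays the role of `k`,
and its kernel has rank one less. -/
theorem WeightFaithful.of_coordinates (hF : IsIsolatedFiltration F) {v : ℕ} (hv : 1 ≤ v)
    (hfaith : WeightFaithful F (F (v + 1))) (r : ℕ) :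
    ∀ (N : Subgroup G) (φ : G → Fin r → ℤ), N ≤ F v → F (v + 1) ≤ N →
      (∀ g ∈ N, ∀ h ∈ N, φ (g * h) = φ g + φ h) →
      (∀ g ∈ N, φ g = 0 ↔ g ∈ F (v + 1)) → (∀ i, ∃ t ∈ N, φ t = Pi.single i 1) →
      WeightFaithful F N := by
  induction r with
  | zero =>
    intro N φ _ hvN _ hφ0 _
    rwa [← le_antisymm hvN fun g hg => (hφ0 g hg).1 (Subsingleton.elim _ _)]
  | succ r ih =>
    intro N φ hNv hvN hφ hφ0 hφs
    have hφ1 : φ 1 = 0 := (hφ0 1 (one_mem _)).2 (one_mem _)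
    have hφv : ∀ g ∈ F (v + 1), φ g = 0 := fun g hg => (hφ0 g (hvN hg)).2 hg
    let N' : Subgroup G :=
      { carrier := {g | g ∈ N ∧ φ g 0 = 0}
        one_mem' := ⟨one_mem _, by rw [hφ1]; rfl⟩
        mul_mem' := fun {a b} ha hb => ⟨mul_mem ha.1 hb.1, by
          rw [hφ a ha.1 b hb.1, Pi.add_apply, ha.2, hb.2, add_zero]⟩
        inv_mem' := fun {a} ha => ⟨inv_mem ha.1, by
          have := congrFun (hφ a ha.1 a⁻¹ (inv_mem ha.1)) 0
          rw [mul_inv_cancel, hφ1, Pi.add_apply, ha.2, zero_add] at this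
          exact this.symm⟩ }
    obtain ⟨t, ht, hφt⟩ := hφs 0
    refine WeightFaithful.of_ker hF hv (N' := N') (k := fun g => φ g 0) hNv hvN
      (fun g hg h hh => by simp only [hφ g hg h hh, Pi.add_apply])
      (fun g hg => by simp only [hφv g hg, Pi.zero_apply]) ht (by simp [hφt])
      (fun g => Iff.rfl) ?_
    refine ih N' (fun g i => φ g i.succ) (fun g hg => hNv hg.1)
      (fun g hg => ⟨hvN hg, by rw [hφv g hg]; rfl⟩) (fun g hg h hh => ?_) (fun g hg => ?_)
      fun i => ?_
    · ext i
      simp [hφ g hg.1 h hh.1]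
    · rw [← hφ0 g hg.1]
      constructor
      · intro h
        ext i
        refine Fin.cases hg.2 (fun i => congrFun h i) i
      · intro h
        ext i
        rw [h]; rfl
    · obtain ⟨t, ht, hφt⟩ := hφs i.succ
      refine ⟨t, ⟨ht, by simp [hφt, (Fin.succ_ne_zero i).symm]⟩, ?_⟩
      ext j
      simp [hφt, Pi.single_apply]

end IsIsolatedFiltration

/-! ### Integral coordinates on the factors, and faithfulness of the weights. -/

theorem isTorsionFree_int_of_nsmul {M : Type*} [AddCommGroup M]
    (h : ∀ (m : ℕ) (x : M), m ≠ 0 → m • x = 0 → x = 0) : Module.IsTorsionFree ℤ M := by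
  rw [Module.isTorsionFree_iff_smul_eq_zero]
  intro r x hr
  refine or_iff_not_imp_left.2 fun hr0 => h r.natAbs x (Int.natAbs_ne_zero.2 hr0) ?_
  rcases Int.natAbs_eq r with e | e <;> rw [e] at hr <;> simpa using hr

namespace IsIsolatedFiltration

open MonoidAlgebra

variable {G : Type*} [Group G] {F : ℕ → Subgroup G}

/-- Allows `F v` to be replaced by a subgroup finitely generated modulo `F (v + 1)`, so that no
finiteness of `F v` is needed. -/
theorem exists_finite_mem_weightSpan {N : Subgroup G} {n : ℕ} {u : MonoidAlgebra ℚ G}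
    (hu : u ∈ weightSpan F N n) :
    ∃ T : Set G, T.Finite ∧ T ⊆ N ∧ ∀ N' : Subgroup G, T ⊆ N' → u ∈ weightSpan F N' n := by
  have key : ∀ m u, IsWeightedProduct F N m u → ∃ T : Set G, T.Finite ∧ T ⊆ N ∧
      ∀ N' : Subgroup G, T ⊆ N' → IsWeightedProduct F N' m u := by
    intro m u hu
    induction hu with
    | one => exact ⟨∅, Set.finite_empty, Set.empty_subset _, fun _ _ => .one⟩
    | @mul m w u g _ hg hw ih =>
      obtain ⟨T, hT, hTN, h⟩ := ih
      exact ⟨insert g T, hT.insert g, Set.insert_subset hg hTN, fun N' hN' =>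
        (h N' ((Set.subset_insert _ _).trans hN')).mul (hN' (Set.mem_insert _ _)) hw⟩
  induction hu using Submodule.span_induction with
  | mem u h =>
    obtain ⟨m, hm, hu⟩ := h
    obtain ⟨T, hT, hTN, h⟩ := key m u hu
    exact ⟨T, hT, hTN, fun N' hN' => Submodule.subset_span ⟨m, hm, h N' hN'⟩⟩
  | zero => exact ⟨∅, Set.finite_empty, Set.empty_subset _, fun _ _ => zero_mem _⟩
  | add u v _ _ hu hv =>
    obtain ⟨T, hT, hTN, h⟩ := hu
    obtain ⟨T', hT', hTN', h'⟩ := hv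
    exact ⟨T ∪ T', hT.union hT', Set.union_subset hTN hTN', fun N' hN' =>
      add_mem (h N' (Set.subset_union_left.trans hN')) (h' N' (Set.subset_union_right.trans hN'))⟩
  | smul a u _ hu =>
    obtain ⟨T, hT, hTN, h⟩ := hu
    exact ⟨T, hT, hTN, fun N' hN' => Submodule.smul_mem _ a (h N' hN')⟩

open scoped IsMulCommutative in
/-- A finitely generated subgroup of the torsion-free abelian group `F v ⧸ F (v + 1)` has integral
coordinates. -/
theorem exists_coordinates (hF : IsIsolatedFiltration F) {v : ℕ} (hv : 1 ≤ v) {T : Set G}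
    (hT : T.Finite) (hTv : T ⊆ F v) :
    ∃ (N : Subgroup G) (r : ℕ) (φ : G → Fin r → ℤ), T ⊆ N ∧ N ≤ F v ∧ F (v + 1) ≤ N ∧
      (∀ g ∈ N, ∀ h ∈ N, φ (g * h) = φ g + φ h) ∧
      (∀ g ∈ N, φ g = 0 ↔ g ∈ F (v + 1)) ∧ (∀ i, ∃ t ∈ N, φ t = Pi.single i 1) := by
  classical
  have := (hF.isolated (v + 1)).normal
  let π := QuotientGroup.mk' (F (v + 1))
  have hπ : ∀ g, π g = 1 ↔ g ∈ F (v + 1) := fun g => QuotientGroup.eq_one_iff g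
  let Q := Subgroup.closure (π '' T)
  have hcomm : ∀ x ∈ π '' T, ∀ y ∈ π '' T, x * y = y * x := by
    rintro _ ⟨x, hx, rfl⟩ _ ⟨y, hy, rfl⟩
    rw [← commutatorElement_eq_one_iff_mul_comm, ← map_commutatorElement, hπ]
    exact hF.antitone (by omega : v + 1 ≤ v + v)
      (hF.commutator_le v v (Subgroup.commutator_mem_commutator (hTv hx) (hTv hy)))
  have : IsMulCommutative Q := Subgroup.isMulCommutative_closure hcomm
  have hfg : Group.FG Q := (Group.fg_iff_subgroup_fg _).2 ⟨(hT.image π).toFinset, by simp [Q]⟩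
  have : Module.Finite ℤ (Additive Q) := by
    rw [Module.Finite.iff_addGroup_fg]
    exact GroupFG.iff_add_fg.1 hfg
  have htf : ∀ (m : ℕ) (x : Q), m ≠ 0 → x ^ m = 1 → x = 1 := by
    intro m ⟨x, hx⟩ hm h
    obtain ⟨x, rfl⟩ := QuotientGroup.mk'_surjective _ x
    have h1 : π x ^ m = 1 := congrArg Subtype.val h
    rw [← map_pow, hπ] at h1
    exact Subtype.ext ((hπ x).2 ((hF.isolated (v + 1)).mem_of_pow_mem x m hm h1))
  have : Module.IsTorsionFree ℤ (Additive Q) :=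
    isTorsionFree_int_of_nsmul fun m x hm hx => htf m x.toMul hm hx
  let b := Module.finBasis ℤ (Additive Q)
  have hker : F (v + 1) ≤ Q.comap π := fun g hg => by
    rw [Subgroup.mem_comap, (hπ g).2 hg]; exact one_mem _
  -- The default `0` off the preimage of `Q` is never used.
  let φ : G → Fin (Module.finrank ℤ (Additive Q)) → ℤ := fun g =>
    if h : π g ∈ Q then b.equivFun (Additive.ofMul ⟨π g, h⟩) else 0
  have hφ : ∀ g (h : π g ∈ Q), φ g = b.equivFun (Additive.ofMul ⟨π g, h⟩) := fun g h => dif_pos h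
  refine ⟨Q.comap π, _, φ, ?_, ?_, hker, ?_, ?_, ?_⟩
  · exact fun g hg => Subgroup.subset_closure ⟨g, hg, rfl⟩
  · have : Q ≤ (F v).map π := (Subgroup.closure_le _).2 (Set.image_mono hTv)
    refine (Subgroup.comap_mono this).trans ?_
    rw [Subgroup.comap_map_eq, QuotientGroup.ker_mk']
    exact sup_le le_rfl (hF.antitone (by omega))
  · intro g hg h hh
    rw [hφ g hg, hφ h hh, hφ (g * h) (mul_mem hg hh), ← map_add]
    congr 1
  · intro g hg
    rw [hφ g hg, LinearEquiv.map_eq_zero_iff, ← hπ]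
    exact Subtype.ext_iff
  · intro i
    obtain ⟨t, ht⟩ := QuotientGroup.mk'_surjective (F (v + 1)) (b i).toMul.1
    have htQ : π t ∈ Q := by simp only [π, ht]; exact (b i).toMul.2
    refine ⟨t, htQ, ?_⟩
    rw [hφ t htQ]
    have : Additive.ofMul (⟨π t, htQ⟩ : Q) = b i := Subtype.ext ht
    ext j
    rw [this, Module.Basis.equivFun_self, Pi.single_apply]
    simp only [eq_comm]

/-- Downward induction on `v` from the trivial group `F (c + 1)`; a given relation involves finitely
many elements, which integral coordinates on `F v / F (v + 1)` handle. -/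
theorem weightFaithful (hF : IsIsolatedFiltration F) {c : ℕ} (hc : F (c + 1) = ⊥) :
    WeightFaithful F (F 1) := by
  have key : ∀ j v, 1 ≤ v → c + 1 ≤ v + j → WeightFaithful F (F v) := by
    intro j
    induction j with
    | zero =>
      intro v _ hv n x hx _
      have : x ∈ F (c + 1) := hF.antitone hv hx
      rw [hc, Subgroup.mem_bot] at this
      exact this ▸ one_mem _
    | succ j ih =>
      intro v hv hj n x hx hxn
      obtain ⟨T, hT, hTv, h⟩ := exists_finite_mem_weightSpan hxn
      obtain ⟨N, r, φ, hTN, hNv, hvN, h1, h2, h3⟩ := exists_coordinates hF hv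
        (hT.insert x) (Set.insert_subset hx hTv)
      exact WeightFaithful.of_coordinates hF hv (ih (v + 1) (by omega) (by omega)) r N φ hNv hvN
        h1 h2 h3 n x (hTN (Set.mem_insert _ _)) (h N ((Set.subset_insert _ _).trans hTN))
  exact key c 1 le_rfl (by omega)

end IsIsolatedFiltration

/-! ### Powers of the augmentation ideal. -/

namespace differenceIdeal

open MonoidAlgebra

variable {K G : Type*} [Field K] [Group G]

theorem of_sub_one_mem (x : G) : of K G x - 1 ∈ differenceIdeal K G := by
  rw [RingHom.mem_ker, map_sub, MonoidAlgebra.lift_of, MonoidHom.one_apply,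
    map_one (MonoidAlgebra.lift K K G _), sub_self]

theorem mem_span_of_sub_one {u : MonoidAlgebra K G} (hu : u ∈ differenceIdeal K G) :
    u ∈ Submodule.span K (Set.range fun g => of K G g - 1) := by
  have key : ∀ u : MonoidAlgebra K G, u - MonoidAlgebra.lift K K G (1 : G →* K) u • 1 ∈
      Submodule.span K (Set.range fun g => of K G g - 1) := by
    intro u
    induction u using MonoidAlgebra.induction_on with
    | of g =>
      refine Submodule.subset_span ⟨g, ?_⟩
      rw [MonoidAlgebra.lift_of, MonoidHom.one_apply, one_smul]
    | add x y hx hy =>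
      rw [map_add, add_smul, add_sub_add_comm]
      exact add_mem hx hy
    | smul a x hx =>
      rw [map_smul, smul_assoc, ← smul_sub]
      exact Submodule.smul_mem _ a hx
  have h := key u
  rw [RingHom.mem_ker] at hu
  have hu' : MonoidAlgebra.lift K K G (1 : G →* K) u = 0 := hu
  rwa [hu', zero_smul, sub_zero] at h

/-- Since `Δ` is spanned over `K` by the `g - 1`, `Δⁿ⁺¹` is spanned by the `u * (g - 1)` with `u ∈
Δⁿ`. -/
theorem pow_induction (P : ℕ → Submodule K (MonoidAlgebra K G)) (h0 : ∀ g, of K G g ∈ P 0)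
    (hmul : ∀ n, ∀ u ∈ P n, ∀ g, u * (of K G g - 1) ∈ P (n + 1)) (n : ℕ)
    {u : MonoidAlgebra K G} (hu : u ∈ differenceIdeal K G ^ n) : u ∈ P n := by
  induction n generalizing u with
  | zero =>
    clear hu
    induction u using MonoidAlgebra.induction_on with
    | of g => exact h0 g
    | add x y hx hy => exact add_mem hx hy
    | smul a x hx => exact Submodule.smul_mem _ a hx
  | succ n ih =>
    rw [Submodule.pow_succ] at hu
    refine Submodule.smul_induction_on hu (fun a ha b hb => ?_) fun x y hx hy => add_mem hx hy
    have hle : Submodule.span K (Set.range fun g => of K G g - 1) ≤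
        (P (n + 1)).comap (LinearMap.mulLeft K a) :=
      Submodule.span_le.2 fun _ ⟨g, hg⟩ => hg ▸ hmul n a (ih ha) g
    exact hle (mem_span_of_sub_one hb)

theorem pow_le_weightSpan {F : ℕ → Subgroup G} (h1 : F 1 = ⊤) (h0 : F 0 = ⊤) (n : ℕ)
    {u : MonoidAlgebra ℚ G} (hu : u ∈ differenceIdeal ℚ G ^ n) : u ∈ weightSpan F ⊤ n := by
  refine pow_induction (weightSpan F ⊤) (fun g => ?_) (fun n u hu g => ?_) n hu
  · simpa only [one_mul] using IsIsolatedFiltration.mul_of_mem_weightSpan h0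
      IsIsolatedFiltration.one_mem_weightSpan (Subgroup.mem_top g)
  · exact IsIsolatedFiltration.mul_of_sub_one_mem_weightSpan hu (Subgroup.mem_top g)
      (h1 ▸ Subgroup.mem_top g)

end differenceIdeal

theorem eq_one_of_sub_one_mem_differenceIdeal_pow {G : Type*} [Group G] [Group.IsNilpotent G]
    (htf : ∀ x : G, x ≠ 1 → ¬ IsOfFinOrder x) {x : G}
    (hx : MonoidAlgebra.of ℚ G x - 1 ∈ differenceIdeal ℚ G ^ (Group.nilpotencyClass G + 1)) :
    x = 1 := by
  have hF := isIsolatedFiltration_isolator_lowerCentralSeries G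
  have hc : ((⊤ : Subgroup G).lowerCentralSeries (Group.nilpotencyClass G + 1 - 1)).isolator
      = ⊥ := by
    rw [Nat.add_sub_cancel, Subgroup.lowerCentralSeries_nilpotencyClass, eq_bot_iff]
    refine Subgroup.isolator_le ⟨inferInstance, fun x m hm h => ?_⟩ le_rfl
    rw [Subgroup.mem_bot] at h ⊢
    by_contra hx
    exact htf x hx (isOfFinOrder_iff_pow_eq_one.2 ⟨m, Nat.pos_of_ne_zero hm, h⟩)
  have h1 : ((⊤ : Subgroup G).lowerCentralSeries (1 - 1)).isolator = ⊤ := hF.zero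
  have := hF.weightFaithful hc
  rw [h1] at this
  have := this _ x (Subgroup.mem_top x) (differenceIdeal.pow_le_weightSpan h1 hF.zero _ hx)
  exact Subgroup.mem_bot.1 (hc ▸ this)

/-! ### Unitriangular bases and finite generation. -/

/-- A module with a finite filtration by isolated submodules has a basis with respect to which
every operator acting trivially on the factors of the filtration is unitriangular. -/
theorem exists_unitriangular_basis {M ι : Type*} [AddCommGroup M] (F : ℕ → Submodule ℤ M)
    (hF : Antitone F) {n : ℕ} (hn : F n = ⊥) (hfg : (F 0).FG)
    (htf : ∀ (k m : ℕ) (x : M), m ≠ 0 → x ∈ F 0 → m • x ∈ F k → x ∈ F k)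
    (T : ι → M → M) (hT : ∀ k i x, x ∈ F k → T i x - x ∈ F (k + 1)) :
    ∃ (d : ℕ) (b : Fin d → M), LinearIndependent ℤ b ∧ Submodule.span ℤ (Set.range b) = F 0 ∧
      ∀ i x, T x (b i) - b i ∈ Submodule.span ℤ (b '' {j | i < j}) := by
  suffices key : ∀ j k, k + j = n → ∃ (d : ℕ) (b : Fin d → M), LinearIndependent ℤ b ∧
      Submodule.span ℤ (Set.range b) = F k ∧
      ∀ i x, T x (b i) - b i ∈ Submodule.span ℤ (b '' {j | i < j}) from key n 0 (zero_add n)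
  intro j
  induction j with
  | zero =>
    rintro k rfl
    exact ⟨0, Fin.elim0, linearIndependent_empty_type, by simpa using hn.symm, fun i => i.elim0⟩
  | succ j ih =>
    intro k hk
    obtain ⟨d, b, hb, hspan, htri⟩ := ih (k + 1) (by omega)
    let Q := (F k).map (F (k + 1)).mkQ
    have : IsNoetherian ℤ (F 0) := isNoetherian_of_fg_of_noetherian _ hfg
    have hkfg : (F k).FG := by
      have := (isNoetherian_submodule.1 this) (F k) (hF (Nat.zero_le k))
      exact this
    have : Module.Finite ℤ Q := Module.Finite.iff_fg.2 (hkfg.map _)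
    have : Module.IsTorsionFree ℤ Q := isTorsionFree_int_of_nsmul fun m x hm hx => by
      obtain ⟨_, x, hxk, rfl⟩ := x
      have h : (F (k + 1)).mkQ (m • x) = 0 := by
        rw [map_nsmul]; exact congrArg Subtype.val hx
      rw [Submodule.mkQ_apply, Submodule.Quotient.mk_eq_zero] at h
      refine Subtype.ext ?_
      exact (Submodule.Quotient.mk_eq_zero _).2 (htf _ m x hm (hF (Nat.zero_le k) hxk) h)
    let e := Module.finBasis ℤ Q
    choose g hgk hg using fun i => (e i).2
    have hbk : ∀ i, b i ∈ F (k + 1) := fun i => hspan ▸ Submodule.subset_span ⟨i, rfl⟩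
    let f : Fin d → F (k + 1) := fun i => ⟨b i, hbk i⟩
    have hf : LinearIndependent ℤ f := LinearIndependent.of_comp (F (k + 1)).subtype hb
    have hgQ : Submodule.Quotient.mk (p := F (k + 1)) ∘ g = Q.subtype ∘ e := funext hg
    have hLI := hf.sumElim_of_quotient g
      (by rw [hgQ]; exact e.linearIndependent.map' _ (Submodule.ker_subtype Q))
    -- The lifts `g` precede `b`, so that `F (k + 1)`, where `T i x - x` lands, is spanned by later
    -- vectors.
    refine ⟨_, Fin.append g b, ?_, ?_, ?_⟩
    · rw [← linearIndependent_equiv ((Equiv.sumComm _ _).trans finSumFinEquiv)]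
      have : Fin.append g b ∘ (Equiv.sumComm _ _).trans finSumFinEquiv =
          Sum.elim (fun x => (f x : M)) g := by
        ext i
        rcases i with i | i <;> simp [f]
      rw [this]
      exact hLI
    · have hmap : (Submodule.span ℤ (Set.range g)).map (F (k + 1)).mkQ =
          (F k).map (F (k + 1)).mkQ := by
        rw [Submodule.map_span, ← Set.range_comp]
        have : ⇑(F (k + 1)).mkQ ∘ g = Q.subtype ∘ e := hgQ
        rw [this, Set.range_comp, ← Submodule.map_span, e.span_eq, Submodule.map_top,
          Submodule.range_subtype]
      have := congrArg (Submodule.comap (F (k + 1)).mkQ) hmap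
      rw [Submodule.comap_map_mkQ, Submodule.comap_map_mkQ,
        sup_eq_right.2 (hF (Nat.le_succ k))] at this
      have hrange : Set.range (Fin.append g b) = Set.range b ∪ Set.range g := by
        refine Set.Subset.antisymm (Set.range_subset_iff.2 fun i => ?_) (Set.union_subset
          (Set.range_subset_iff.2 fun i => ⟨Fin.natAdd _ i, Fin.append_right g b i⟩)
          (Set.range_subset_iff.2 fun i => ⟨Fin.castAdd _ i, Fin.append_left g b i⟩))
        refine Fin.addCases (fun i => ?_) (fun i => ?_) i
        · rw [Fin.append_left]; exact .inr ⟨i, rfl⟩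
        · rw [Fin.append_right]; exact .inl ⟨i, rfl⟩
      refine Eq.trans ?_ this
      rw [hrange, Submodule.span_union, hspan]
    · refine fun i x => Fin.addCases (fun i => ?_) (fun i => ?_) i
      · rw [Fin.append_left]
        have h := hT k x _ (hgk i)
        rw [← hspan] at h
        refine Submodule.span_mono ?_ h
        rintro _ ⟨j, rfl⟩
        exact ⟨Fin.natAdd _ j, by simp [Fin.lt_def]; omega, Fin.append_right g b j⟩
      · rw [Fin.append_right]
        refine Submodule.span_mono ?_ (htri i x)
        rintro _ ⟨j, hj, rfl⟩
        exact ⟨Fin.natAdd _ j, by simpa using hj, Fin.append_right g b j⟩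

/-- If the augmentation ideal of a finitely generated group acts nilpotently on a ring, then the
image of the integral group ring is finitely generated as an abelian group. -/
theorem fg_span_range_of_nilpotent {G R : Type*} [Group G] [Group.FG G] [Ring R] (f : G →* R)
    (J : ℕ → Set R) (h1 : 1 ∈ J 0) (hJ : ∀ m, ∀ u ∈ J m, ∀ g, u * (f g - 1) ∈ J (m + 1))
    {n : ℕ} (hn : ∀ u ∈ J n, u = 0) :
    (Submodule.span ℤ (Set.range f)).FG := by
  obtain ⟨S, hS, hSfin⟩ := (Group.fg_iff (G := G)).1 inferInstance
  -- `W m` consists of products of `m` factors `f s - 1`; inverses are included so that `S'`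
  -- generates `G` as a monoid. The span `M` of products of fewer than `n` factors is stable, as `u
  -- * f g = u * (f g - 1) + u` and products of length `n` vanish.
  let S' := S ∪ S⁻¹
  have hS' : S'.Finite := hSfin.union hSfin.inv
  let W : ℕ → Set R := fun m => Nat.rec {1} (fun _ A => Set.image2 (fun u g => u * (f g - 1)) A S') m
  have hWfin : ∀ m, (W m).Finite := fun m => by
    induction m with
    | zero => exact Set.finite_singleton 1
    | succ m ih => exact ih.image2 _ hS'
  have hWJ : ∀ m, W m ⊆ J m := fun m => by
    induction m with
    | zero => exact Set.singleton_subset_iff.2 h1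
    | succ m ih =>
      rintro _ ⟨u, hu, g, -, rfl⟩
      exact hJ m u (ih hu) g
  let M := Submodule.span ℤ (⋃ m ∈ Set.Iio n, W m)
  have hWM : ∀ m ≤ n, ∀ u ∈ W m, u ∈ M := fun m hm u hu => by
    rcases hm.lt_or_eq with h | rfl
    · exact Submodule.subset_span (Set.mem_biUnion (Set.mem_Iio.2 h) hu)
    · rw [hn u (hWJ _ hu)]
      exact zero_mem _
  have hmul : ∀ g ∈ S', ∀ u ∈ M, u * f g ∈ M := fun g hg u hu => by
    induction hu using Submodule.span_induction with
    | mem u hu =>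
      obtain ⟨m, hm, hu⟩ := Set.mem_iUnion₂.1 hu
      have hm : m < n := hm
      have := add_mem (hWM (m + 1) hm _ ⟨u, hu, g, hg, rfl⟩) (hWM m hm.le u hu)
      simpa [mul_sub] using this
    | zero => simp
    | add u v _ _ hu hv => rw [add_mul]; exact add_mem hu hv
    | smul a u _ hu => rw [smul_mul_assoc]; exact Submodule.smul_mem _ a hu
  have hG : ∀ x, f x ∈ M := fun x => by
    have hx : x ∈ Subgroup.closure S := hS ▸ Subgroup.mem_top x
    induction hx using Subgroup.closure_induction_right with
    | one => rw [map_one]; exact hWM 0 (Nat.zero_le n) 1 rfl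
    | mul_right x _ y hy ih => rw [map_mul]; exact hmul y (.inl hy) _ ih
    | mul_inv_cancel x _ y hy ih =>
      rw [map_mul]; exact hmul _ (.inr (Set.inv_mem_inv.2 hy)) _ ih
  have hMfg : M.FG := Submodule.fg_span ((Set.finite_Iio n).biUnion fun m _ => hWfin m)
  have : IsNoetherian ℤ M := isNoetherian_of_fg_of_noetherian _ hMfg
  exact isNoetherian_submodule.1 this _ (Submodule.span_le.2 (Set.range_subset_iff.2 hG))

/-! ### The integral lattice and extension of scalars. -/

open MonoidAlgebra

section
variable {K G : Type*} [Field K] [Group G]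

theorem groupToQuotient_apply (n : ℕ) (x : G) :
    groupToQuotient K G n x = Ideal.Quotient.mk (differenceIdeal K G ^ n) (of K G x) := rfl

theorem differenceIdeal.mul_of_sub_one_mem_pow {n : ℕ} {u : MonoidAlgebra K G}
    (hu : u ∈ differenceIdeal K G ^ n) (g : G) :
    u * (of K G g - 1) ∈ differenceIdeal K G ^ (n + 1) := by
  rw [Submodule.pow_succ]
  exact Ideal.mul_mem_mul hu (of_sub_one_mem g)

/-- The filtration of the subring of integral combinations of group elements in `ℚ G / Δ ^ n` by
the images of the powers of `Δ`. -/
noncomputable def integralFiltration (G : Type*) [Group G] (n k : ℕ) :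
    Submodule ℤ (DifferenceQuotient ℚ G n) :=
  Submodule.span ℤ (Set.range (groupToQuotient ℚ G n)) ⊓
    ((differenceIdeal ℚ G ^ k).toAddSubgroup.map
      (Ideal.Quotient.mk (differenceIdeal ℚ G ^ n)).toAddMonoidHom).toIntSubmodule

theorem mem_integralFiltration {n k : ℕ} {y : DifferenceQuotient ℚ G n} :
    y ∈ integralFiltration G n k ↔ y ∈ Submodule.span ℤ (Set.range (groupToQuotient ℚ G n)) ∧
      ∃ u ∈ differenceIdeal ℚ G ^ k, Ideal.Quotient.mk (differenceIdeal ℚ G ^ n) u = y := Iff.rfl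

theorem integralFiltration_zero (n : ℕ) :
    integralFiltration G n 0 = Submodule.span ℤ (Set.range (groupToQuotient ℚ G n)) := by
  ext y
  rw [mem_integralFiltration, and_iff_left_iff_imp]
  obtain ⟨u, rfl⟩ := Ideal.Quotient.mk_surjective y
  exact fun _ => ⟨u, by rw [Submodule.pow_zero]; simp, rfl⟩

theorem mul_groupToQuotient_mem_span {n : ℕ} {y : DifferenceQuotient ℚ G n}
    (hy : y ∈ Submodule.span ℤ (Set.range (groupToQuotient ℚ G n))) (x : G) :
    y * groupToQuotient ℚ G n x ∈ Submodule.span ℤ (Set.range (groupToQuotient ℚ G n)) := by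
  induction hy using Submodule.span_induction with
  | mem y hy =>
    obtain ⟨g, rfl⟩ := hy
    exact Submodule.subset_span ⟨g * x, map_mul _ g x⟩
  | zero => simp
  | add u v _ _ hu hv => rw [add_mul]; exact add_mem hu hv
  | smul a u _ hu => rw [smul_mul_assoc]; exact Submodule.smul_mem _ a hu

theorem exists_integral_unitriangular_basis (G : Type*) [Group G] [Group.FG G] (n : ℕ) :
    ∃ (d : ℕ) (b : Fin d → DifferenceQuotient ℚ G n), LinearIndependent ℤ b ∧
      Submodule.span ℤ (Set.range b) = Submodule.span ℤ (Set.range (groupToQuotient ℚ G n)) ∧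
      ∀ i x, b i * groupToQuotient ℚ G n x - b i ∈ Submodule.span ℤ (b '' {j | i < j}) := by
  rw [← integralFiltration_zero]
  refine exists_unitriangular_basis (integralFiltration G n) ?_ (n := n) ?_ ?_ ?_
    (fun x y => y * groupToQuotient ℚ G n x) ?_
  · exact fun i j h => fun y hy =>
      have ⟨h1, u, hu, e⟩ := mem_integralFiltration.1 hy
      mem_integralFiltration.2 ⟨h1, u, Ideal.pow_le_pow_right h hu, e⟩
  · rw [eq_bot_iff]
    rintro y hy
    obtain ⟨-, u, hu, rfl⟩ := mem_integralFiltration.1 hy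
    exact (Submodule.mem_bot _).2 (Ideal.Quotient.eq_zero_iff_mem.2 hu)
  · rw [integralFiltration_zero]
    refine fg_span_range_of_nilpotent (groupToQuotient ℚ G n)
      (fun k => Ideal.Quotient.mk (differenceIdeal ℚ G ^ n) '' (differenceIdeal ℚ G ^ k : Ideal _))
      ⟨1, by rw [Submodule.pow_zero]; simp, map_one _⟩ ?_ (n := n) ?_
    · rintro m _ ⟨u, hu, rfl⟩ g
      exact ⟨_, differenceIdeal.mul_of_sub_one_mem_pow hu g, by
        rw [map_mul, map_sub, map_one (Ideal.Quotient.mk _), groupToQuotient_apply]⟩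
    · rintro _ ⟨u, hu, rfl⟩
      exact Ideal.Quotient.eq_zero_iff_mem.2 hu
  · intro k m y hm hy hmy
    rw [integralFiltration_zero] at hy
    obtain ⟨-, u, hu, e⟩ := mem_integralFiltration.1 hmy
    -- Isolation: `Δᵏ` is a rational subspace, so division by `m` stays inside it.
    refine mem_integralFiltration.2 ⟨hy, (m : ℚ)⁻¹ • u, ?_, ?_⟩
    · exact Submodule.smul_of_tower_mem _ _ hu
    · obtain ⟨v, rfl⟩ := Ideal.Quotient.mk_surjective y
      rw [← map_nsmul, Ideal.Quotient.eq] at e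
      rw [Ideal.Quotient.eq]
      have := Submodule.smul_of_tower_mem _ (m : ℚ)⁻¹ e
      rwa [smul_sub, ← Nat.cast_smul_eq_nsmul ℚ, inv_smul_smul₀ (Nat.cast_ne_zero.2 hm)] at this
  · intro k x y hy
    obtain ⟨h, u, hu, rfl⟩ := mem_integralFiltration.1 hy
    refine mem_integralFiltration.2 ⟨sub_mem (mul_groupToQuotient_mem_span h x) h,
      _, differenceIdeal.mul_of_sub_one_mem_pow hu x, ?_⟩
    rw [map_mul, map_sub, map_one (Ideal.Quotient.mk _), groupToQuotient_apply, mul_sub, mul_one]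

theorem lift_mem_differenceIdeal_pow [CharZero K] {n : ℕ} {u : MonoidAlgebra ℚ G}
    (hu : u ∈ differenceIdeal ℚ G ^ n) :
    MonoidAlgebra.lift ℚ (MonoidAlgebra K G) G (of K G) u ∈ differenceIdeal K G ^ n := by
  let ι := MonoidAlgebra.lift ℚ (MonoidAlgebra K G) G (of K G)
  have := differenceIdeal.pow_induction (K := ℚ) (G := G)
    (fun n => ((differenceIdeal K G ^ n).restrictScalars ℚ).comap ι.toLinearMap) ?_ ?_ n hu
  · exact this
  · intro g
    change ι (of ℚ G g) ∈ differenceIdeal K G ^ 0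
    rw [Submodule.pow_zero]; simp
  · intro n u hu g
    change ι (u * (of ℚ G g - 1)) ∈ differenceIdeal K G ^ (n + 1)
    rw [map_mul, map_sub, map_one, show ι (of ℚ G g) = of K G g from MonoidAlgebra.lift_of _ _]
    exact differenceIdeal.mul_of_sub_one_mem_pow hu g

/-- Extension of scalars from `ℚ G / Δ ^ n` to `K G / Δ ^ n`. -/
noncomputable def extendScalars (K G : Type*) [Field K] [CharZero K] [Group G] (n : ℕ) :
    DifferenceQuotient ℚ G n →+* DifferenceQuotient K G n :=
  Ideal.quotientMap _ (MonoidAlgebra.lift ℚ (MonoidAlgebra K G) G (of K G)).toRingHom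
    fun _ hu => lift_mem_differenceIdeal_pow hu

theorem extendScalars_mk [CharZero K] (n : ℕ) (u : MonoidAlgebra ℚ G) :
    extendScalars K G n (Ideal.Quotient.mk _ u) =
      Ideal.Quotient.mk _ (MonoidAlgebra.lift ℚ (MonoidAlgebra K G) G (of K G) u) := rfl

theorem extendScalars_groupToQuotient [CharZero K] (n : ℕ) (x : G) :
    extendScalars K G n (groupToQuotient ℚ G n x) = groupToQuotient K G n x := by
  rw [groupToQuotient_apply, extendScalars_mk, MonoidAlgebra.lift_of, groupToQuotient_apply]

/-- The powers of the difference ideal over `K` are spanned by integral elements. -/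
theorem differenceIdeal.pow_le_span_integral {n : ℕ} {u : MonoidAlgebra K G}
    (hu : u ∈ differenceIdeal K G ^ n) :
    u ∈ Submodule.span K (MonoidAlgebra.lift ℤ (MonoidAlgebra K G) G (of K G) ''
      {w | MonoidAlgebra.lift ℤ (MonoidAlgebra ℚ G) G (of ℚ G) w ∈ differenceIdeal ℚ G ^ n}) := by
  refine pow_induction (fun n => Submodule.span K
    (MonoidAlgebra.lift ℤ (MonoidAlgebra K G) G (of K G) ''
      {w | MonoidAlgebra.lift ℤ (MonoidAlgebra ℚ G) G (of ℚ G) w ∈ differenceIdeal ℚ G ^ n}))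
    (fun g => ?_) (fun n u hu g => ?_) n hu
  · refine Submodule.subset_span ⟨of ℤ G g, ?_, MonoidAlgebra.lift_of _ _⟩
    rw [Set.mem_ofPred_eq, Submodule.pow_zero]; simp
  · induction hu using Submodule.span_induction with
    | mem u hu =>
      obtain ⟨w, hw, rfl⟩ := hu
      refine Submodule.subset_span ⟨w * (of ℤ G g - 1), ?_, ?_⟩
      · rw [Set.mem_ofPred_eq, map_mul, map_sub, map_one (MonoidAlgebra.lift ℤ _ G _),
          MonoidAlgebra.lift_of]
        exact mul_of_sub_one_mem_pow hw g
      · rw [map_mul, map_sub, map_one (MonoidAlgebra.lift ℤ _ G _), MonoidAlgebra.lift_of]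
    | zero => rw [zero_mul]; exact zero_mem _
    | add u v _ _ hu hv => rw [add_mul]; exact add_mem hu hv
    | smul a u _ hu => rw [smul_mul_assoc]; exact Submodule.smul_mem _ a hu

end

section
variable {K G : Type*} [Field K] [CharZero K] [Group G]

theorem extendScalars_mk_lift_int (n : ℕ) (w : MonoidAlgebra ℤ G) :
    extendScalars K G n
        (Ideal.Quotient.mk _ (MonoidAlgebra.lift ℤ (MonoidAlgebra ℚ G) G (of ℚ G) w)) =
      Ideal.Quotient.mk _ (MonoidAlgebra.lift ℤ (MonoidAlgebra K G) G (of K G) w) := by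
  rw [extendScalars_mk]
  congr 1
  have : ((MonoidAlgebra.lift ℚ (MonoidAlgebra K G) G (of K G)).restrictScalars ℤ).comp
      (MonoidAlgebra.lift ℤ (MonoidAlgebra ℚ G) G (of ℚ G)) =
        MonoidAlgebra.lift ℤ (MonoidAlgebra K G) G (of K G) := by
    ext g
    simp
  exact DFunLike.congr_fun this w

theorem exists_lift_int_of_mem_span {n : ℕ} {y : DifferenceQuotient ℚ G n}
    (hy : y ∈ Submodule.span ℤ (Set.range (groupToQuotient ℚ G n))) :
    ∃ w, Ideal.Quotient.mk _ (MonoidAlgebra.lift ℤ (MonoidAlgebra ℚ G) G (of ℚ G) w) = y := by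
  induction hy using Submodule.span_induction with
  | mem y hy =>
    obtain ⟨g, rfl⟩ := hy
    exact ⟨of ℤ G g, by rw [MonoidAlgebra.lift_of, groupToQuotient_apply]⟩
  | zero => exact ⟨0, by rw [map_zero, map_zero]⟩
  | add u v _ _ hu hv =>
    obtain ⟨w, rfl⟩ := hu
    obtain ⟨w', rfl⟩ := hv
    exact ⟨w + w', by rw [map_add, map_add]⟩
  | smul a u _ hu =>
    obtain ⟨w, rfl⟩ := hu
    exact ⟨a • w, by rw [map_zsmul, map_zsmul]⟩

/-- An integral basis over `ℚ` remains linearly independent after extension of scalars. -/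
theorem linearIndependent_extendScalars {n d : ℕ} {b : Fin d → DifferenceQuotient ℚ G n}
    (hb : LinearIndependent ℤ b)
    (hspan : Submodule.span ℤ (Set.range b) =
      Submodule.span ℤ (Set.range (groupToQuotient ℚ G n))) :
    LinearIndependent K fun i => extendScalars K G n (b i) := by
  have hc : ∀ x, ∃ c : Fin d → ℤ, ∑ j, c j • b j = groupToQuotient ℚ G n x := fun x => by
    rw [← Submodule.mem_span_range_iff_exists_fun, hspan]
    exact Submodule.subset_span ⟨x, rfl⟩
  choose c hc using hc
  have huniq : ∀ a a' : Fin d → ℤ, ∑ j, a j • b j = ∑ j, a' j • b j → a = a' := fun a a' h =>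
    hb.fintypeLinearCombination_injective (by simpa [Fintype.linearCombination_apply] using h)
  -- `φ` extends the integral coordinates `K`-linearly. It kills `Δⁿ` over `K`, by its integral
  -- spanning set, and sends integral lifts of the `b i` to unit vectors; hence independence.
  let φ : MonoidAlgebra K G →ₗ[K] (Fin d → K) := linExt fun x j => (c x j : K)
  let ιQ := MonoidAlgebra.lift ℤ (MonoidAlgebra ℚ G) G (of ℚ G)
  let ιK := MonoidAlgebra.lift ℤ (MonoidAlgebra K G) G (of K G)
  have hφ : ∀ w : MonoidAlgebra ℤ G, ∃ a : Fin d → ℤ, (φ (ιK w) = fun j => (a j : K)) ∧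
      Ideal.Quotient.mk (differenceIdeal ℚ G ^ n) (ιQ w) = ∑ j, a j • b j := by
    intro w
    induction w using MonoidAlgebra.induction_on with
    | of g =>
      refine ⟨c g, ?_, ?_⟩
      · rw [show ιK (of ℤ G g) = of K G g from MonoidAlgebra.lift_of _ _]
        exact linExt_of _ _
      · rw [hc, show ιQ (of ℤ G g) = of ℚ G g from MonoidAlgebra.lift_of _ _]
        rfl
    | add x y hx hy =>
      obtain ⟨a, h1, h2⟩ := hx
      obtain ⟨a', h1', h2'⟩ := hy
      refine ⟨a + a', ?_, ?_⟩
      · rw [map_add, map_add, h1, h1']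
        ext j; simp
      · rw [map_add, map_add, h2, h2', ← Finset.sum_add_distrib]
        simp [add_smul]
    | smul r x hx =>
      obtain ⟨a, h1, h2⟩ := hx
      refine ⟨r • a, ?_, ?_⟩
      · rw [map_zsmul, map_zsmul, h1]
        ext j; simp
      · rw [map_zsmul, map_zsmul, h2, Finset.smul_sum]
        simp [mul_smul]
  have hφ0 : ∀ u ∈ differenceIdeal K G ^ n, φ u = 0 := fun u hu => by
    have hle : Submodule.span K (ιK '' {w | ιQ w ∈ differenceIdeal ℚ G ^ n}) ≤ LinearMap.ker φ := by
      rw [Submodule.span_le]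
      rintro _ ⟨w, hw, rfl⟩
      obtain ⟨a, h1, h2⟩ := hφ w
      rw [Ideal.Quotient.eq_zero_iff_mem.2 hw] at h2
      have : a = 0 := huniq a 0 (by rw [← h2]; simp)
      change φ (ιK w) = 0
      rw [h1, this]
      ext j; simp
    exact hle (differenceIdeal.pow_le_span_integral hu)
  choose w hw using fun i => exists_lift_int_of_mem_span (G := G)
    (hspan ▸ Submodule.subset_span ⟨i, rfl⟩ : b i ∈ _)
  have hφw : ∀ i, φ (ιK (w i)) = Pi.single i 1 := fun i => by
    obtain ⟨a, h1, h2⟩ := hφ (w i)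
    have : a = Pi.single i 1 := huniq _ _ (by rw [← h2, hw]; simp [Pi.single_apply])
    rw [h1, this]
    ext j
    simp [Pi.single_apply]
  rw [Fintype.linearIndependent_iff]
  intro k hk i
  have hmem : ∑ i, k i • ιK (w i) ∈ differenceIdeal K G ^ n := by
    rw [← Ideal.Quotient.eq_zero_iff_mem, map_sum, ← hk]
    refine Finset.sum_congr rfl fun i _ => ?_
    rw [← hw i, extendScalars_mk_lift_int]
    rfl
  have := congrFun (hφ0 _ hmem) i
  simpa [map_sum, hφw, Pi.single_apply] using this

theorem span_extendScalars {n d : ℕ} {b : Fin d → DifferenceQuotient ℚ G n}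
    (hspan : Submodule.span ℤ (Set.range b) =
      Submodule.span ℤ (Set.range (groupToQuotient ℚ G n))) :
    ⊤ ≤ Submodule.span K (Set.range fun i => extendScalars K G n (b i)) := by
  rintro y -
  obtain ⟨u, rfl⟩ := Ideal.Quotient.mk_surjective y
  induction u using MonoidAlgebra.induction_on with
  | of g =>
    have hg : groupToQuotient ℚ G n g ∈ Submodule.span ℤ (Set.range b) :=
      hspan ▸ Submodule.subset_span ⟨g, rfl⟩
    obtain ⟨c, hc⟩ := (Submodule.mem_span_range_iff_exists_fun ℤ).1 hg
    rw [← groupToQuotient_apply, ← extendScalars_groupToQuotient, ← hc, map_sum]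
    refine sum_mem fun i _ => ?_
    rw [map_zsmul]
    refine zsmul_mem ?_ _
    exact Submodule.subset_span ⟨i, rfl⟩
  | add x y hx hy => rw [map_add]; exact add_mem hx hy
  | smul a x hx => exact Submodule.smul_mem _ a hx

end

/-! ### The representation. -/

/-- The finitely generated group `G` acts by right multiplication on `K G / Δ ^ n` through
unitriangular integral matrices that do not depend on the field `K` of characteristic zero. -/
theorem exists_unitriangular_representation (G : Type*) [Group G] [Group.FG G] (n : ℕ) :
    ∃ (d : ℕ) (ρ : G →* unitriangularGroup d ℤ),
      (∀ x, ρ x = 1 → of ℚ G x - 1 ∈ differenceIdeal ℚ G ^ n) ∧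
      ∀ (K : Type*) [Field K] [CharZero K],
        ∃ b : Module.Basis (Fin d) K (DifferenceQuotient K G n), IsIntegralBasis b ∧
          ∀ (x : G) (i : Fin d), b i * groupToQuotient K G n x =
            ∑ j, (((ρ x : GL (Fin d) ℤ) i j : ℤ) : K) • b j := by
  obtain ⟨d, b, hb, hspan, htri⟩ := exists_integral_unitriangular_basis G n
  have huniq : ∀ a a' : Fin d → ℤ, ∑ j, a j • b j = ∑ j, a' j • b j → a = a' := fun a a' h =>
    hb.fintypeLinearCombination_injective (by simpa [Fintype.linearCombination_apply] using h)
  have hA : ∀ x i, ∃ a : Fin d → ℤ, (∀ j < i, a j = 0) ∧ a i = 1 ∧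
      b i * groupToQuotient ℚ G n x = ∑ j, a j • b j := fun x i => by
    obtain ⟨l, hl, e⟩ := (Finsupp.mem_span_image_iff_linearCombination ℤ).1 (htri i x)
    have hl0 : ∀ j ≤ i, l j = 0 := fun j hj =>
      Finsupp.notMem_support_iff.1 fun h => absurd (hl h) (not_lt.2 hj)
    -- `l` gives the coordinates of `b i * x - b i`; the added unit vector accounts for `b i`.
    refine ⟨⇑l + Pi.single i 1, fun j hj => ?_, ?_, ?_⟩
    · simp [hl0 j hj.le, hj.ne]
    · simp [hl0 i le_rfl]
    · rw [Finsupp.linearCombination_apply, Finsupp.sum_fintype _ _ (by simp), eq_sub_iff_add_eq]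
        at e
      simp [← e, add_smul, Finset.sum_add_distrib, Pi.single_apply]
  choose A hA0 hA1 hA using hA
  -- Coordinates of `b i * x` form row `i`, so right multiplication yields a homomorphism rather
  -- than an antihomomorphism.
  let M : G →* Matrix (Fin d) (Fin d) ℤ :=
    { toFun := fun x => Matrix.of (A x)
      map_one' := by
        ext i j
        have : A 1 i = Pi.single i 1 := huniq _ _ (by rw [← hA, map_one (groupToQuotient ℚ G n)]; simp [Pi.single_apply])
        rw [Matrix.of_apply, this, Matrix.one_apply, Pi.single_apply]
        simp only [eq_comm]
      map_mul' := fun x y => by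
        ext i j
        have : A (x * y) i = fun j => ∑ k, A x i k * A y k j := huniq _ _ (by
          rw [← hA, map_mul, ← mul_assoc, hA, Finset.sum_mul]
          simp only [smul_mul_assoc, hA, Finset.smul_sum, Finset.sum_smul, mul_smul]
          exact Finset.sum_comm)
        rw [Matrix.of_apply, this, Matrix.mul_apply]
        rfl }
  have hM : ∀ x, ((M.toHomUnits x : GL (Fin d) ℤ) : Matrix (Fin d) (Fin d) ℤ) = Matrix.of (A x) :=
    fun x => rfl
  refine ⟨d, M.toHomUnits.codRestrict _ fun x => ⟨fun i j h => ?_, fun i => ?_⟩, ?_, ?_⟩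
  · exact hA0 x i j h
  · exact hA1 x i
  · intro x hx
    have hx' : M x = 1 := congrArg (fun g : unitriangularGroup d ℤ =>
      ((g : GL (Fin d) ℤ) : Matrix (Fin d) (Fin d) ℤ)) hx
    have hbx : ∀ i, b i * groupToQuotient ℚ G n x = b i := fun i => by
      have h : ∀ j, A x i j = (1 : Matrix (Fin d) (Fin d) ℤ) i j := fun j =>
        congrFun (congrFun hx' i) j
      rw [hA]
      simp [h, Matrix.one_apply]
    have hL : ∀ y ∈ Submodule.span ℤ (Set.range b), y * groupToQuotient ℚ G n x = y := by
      intro y hy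
      induction hy using Submodule.span_induction with
      | mem y hy => obtain ⟨i, rfl⟩ := hy; exact hbx i
      | zero => simp
      | add u v _ _ hu hv => rw [add_mul, hu, hv]
      | smul a u _ hu => rw [smul_mul_assoc, hu]
    -- The lattice contains `1`, so trivial action on it forces the image of `x` to be `1`.
    have h1 := hL 1 (hspan ▸ Submodule.subset_span ⟨1, map_one _⟩)
    rw [one_mul] at h1
    exact Ideal.Quotient.eq.1 h1
  · intro K _ _
    have hKx := extendScalars_groupToQuotient (K := K) (G := G) n
    let B := Module.Basis.mk (linearIndependent_extendScalars (K := K) hb hspan)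
      (span_extendScalars hspan)
    have hB : ∀ i, B i = extendScalars K G n (b i) := fun i => Module.Basis.mk_apply _ _ i
    refine ⟨B, ⟨fun i => ?_, fun x => ?_⟩, fun x i => ?_⟩
    · have hi : b i ∈ Submodule.span ℤ (Set.range (groupToQuotient ℚ G n)) :=
        hspan ▸ Submodule.subset_span ⟨i, rfl⟩
      obtain ⟨m, hm⟩ := Finsupp.mem_span_range_iff_exists_finsupp.1 hi
      refine ⟨m, ?_⟩
      rw [hB, ← hm, map_finsuppSum]
      simp only [map_zsmul, hKx]
    · have hx : groupToQuotient ℚ G n x ∈ Submodule.span ℤ (Set.range b) :=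
        hspan ▸ Submodule.subset_span ⟨x, rfl⟩
      obtain ⟨c, hc⟩ := (Submodule.mem_span_range_iff_exists_fun ℤ).1 hx
      refine ⟨c, ?_⟩
      rw [← hKx, ← hc, map_sum]
      simp only [map_zsmul, hB]
    · rw [hB, ← hKx, ← map_mul, hA, map_sum]
      refine Finset.sum_congr rfl fun j _ => ?_
      rw [map_zsmul, hB]
      exact (Int.cast_smul_eq_zsmul K _ _).symm

theorem theorem7p5 {G : Type*} [Group G] [Group.FG G] [Group.IsNilpotent G]
    (htf : ∀ x : G, x ≠ 1 → ¬ IsOfFinOrder x) :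
    ∃ (d : ℕ) (ρ : G →* unitriangularGroup d ℤ), Function.Injective ρ ∧
      ∀ (K : Type*) [Field K] [CharZero K],
        ∃ b : Module.Basis (Fin d) K
            (DifferenceQuotient K G (Group.nilpotencyClass G + 1)),
          IsIntegralBasis b ∧
            ∀ (x : G) (i : Fin d),
              b i * groupToQuotient K G (Group.nilpotencyClass G + 1) x =
                ∑ j, (((ρ x : GL (Fin d) ℤ) i j : ℤ) : K) • b j := by
  obtain ⟨d, ρ, hρ, h⟩ := exists_unitriangular_representation G (Group.nilpotencyClass G + 1)
  refine ⟨d, ρ, (injective_iff_map_eq_one ρ).2 fun x hx => ?_, h⟩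
  exact eq_one_of_sub_one_mem_differenceIdeal_pow htf (hρ x hx)
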